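/- Let $n,n',d$ be positive integers. Let $\mathcal P^{n\to n'}$ be the set of channels from $[n]$ to $[n']$, i.e. of column stochastic matrices $\mathbf P=(P(y|x))\in\mathbb R^{n'\times n}$. The signaling polytope $\mathcal C_d^{n\to n'}$ is the set of all $\mathbf P\in\mathcal P^{n\to n'}$ of the form $$P(y|x)=\sum_\lambda q(\lambda)\sum_{m\in[d]}R_\lambda(y|m)\,T_\lambda(m|x),$$ where $q$ is a probability mass function on a finite set and $\mathbf T_\lambda\in\mathcal P^{n\to d}$, $\mathbf R_\lambda\in\mathcal P^{d\to n'}$ for every $\lambda$; these are the channels that can be simulated with $d$ messages and shared randomness. For $0\le k\le n'$, the ambiguous polytope $\mathcal A_{k,d}^{n\to n'}$ is the set of all $\mathbf P\in\mathcal P^{n\to n'}$ such that $\sum_{x,y}G_{y,x}P(y|x)\le d$ for every matrix $\mathbf G\in\mathbb R^{n'\times n}$ that has $k$ rows with entries in $\{0,1\}$ and row sum $1$, and whose remaining $n'-k$ rows have all entries equal to $\frac1{n-d+1}$. The maximum likelihood polytope is $\mathcal M_d^{n\to n'}:=\mathcal A_{n',d}^{n\to n'}$ (for $k=n'$ there are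 no rows of the second kind, so this is meaningful for every $d$). (i) If $d=n'-1$, then $$\mathcal C_d^{n\to n'}=\mathcal M_d^{n\to n'}=\Big\{\mathbf P\in\mathcal P^{n\to n'}:\ \sum_{y=1}^{n'}\max_{x\in[n]}P(y|x)\le d\Big\}.$$ In other words, a channel $\mathbf P\in\mathcal P^{n\to n'}$ lies in $\mathcal C_m^{n\to n'}$ for some $1\le m<n'$ if and only if $\mathbf P\in\mathcal M_{n'-1}^{n\to n'}$. (ii) If $d=n-1$, then $$\mathcal C_d^{n\to n'}=\bigcap_{k=n}^{n'}\mathcal A_{k,d}^{n\to n'},$$ where the intersection is taken inside $\mathcal P^{n\to n'}$ (so it is all of $\mathcal P^{n\to n'}$ if $n'<n$). In other words, a channel $\mathbf P\in\mathcal P^{n\to n'}$ lies in $\mathcal C_m^{n\to n'}$ for some $1\le m<n$ if and only if $\mathbf P\in\mathcal A_{k,n-1}^{n\to n'}$ for all $k=n,\dots,n'$. -/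

import Mathlib

/-- The set of channels with input set `[n]` and output set `[n']`, i.e. the column stochastic
`n' × n` real matrices; the entry `P y x` is the conditional probability `P(y|x)`. -/
def channels (n n' : ℕ) : Set (Matrix (Fin n') (Fin n) ℝ) :=
  {P | (∀ y x, 0 ≤ P y x) ∧ ∀ x, ∑ y, P y x = 1}

/-- The signaling polytope: the channels that can be simulated by sending one of `d` messages with
the help of a shared random variable `l` with probability mass function `q`, where Alice
encodes with `T l` and Bob decodes with `R l`. -/
def signalingPolytope (n n' d : ℕ) : Set (Matrix (Fin n') (Fin n) ℝ) :=
  {P | P ∈ channels n n' ∧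
    ∃ (L : ℕ) (q : Fin L → ℝ) (T : Fin L → Matrix (Fin d) (Fin n) ℝ)
      (R : Fin L → Matrix (Fin n') (Fin d) ℝ),
      (∀ l, 0 ≤ q l) ∧ ∑ l, q l = 1 ∧
      (∀ l, T l ∈ channels n d) ∧ (∀ l, R l ∈ channels d n') ∧
      ∀ y x, P y x = ∑ l, q l * ∑ m, R l y m * T l m x}

/-- The Euclidean inner product of two matrices. -/
def matrixInner {n n' : ℕ} (G P : Matrix (Fin n') (Fin n) ℝ) : ℝ :=
  ∑ x, ∑ y, G y x * P y x

/-- `G` is the matrix of an ambiguous guessing game: `k` of its rows (the guessing rows, indexed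
by `S`) are stochastic with entries in `{0, 1}`, and each of the remaining `n' - k` rows (the
ambiguous rows) has all entries equal to `1 / (n - d + 1)`. -/
def IsAmbiguousGame {n n' : ℕ} (k d : ℕ) (G : Matrix (Fin n') (Fin n) ℝ) : Prop :=
  ∃ S : Finset (Fin n'), S.card = k ∧
    (∀ y ∈ S, (∀ x, G y x = 0 ∨ G y x = 1) ∧ ∑ x, G y x = 1) ∧
    (∀ y ∉ S, ∀ x, G y x = 1 / ((n : ℝ) - (d : ℝ) + 1))

/-- The `(k, d)`-ambiguous polytope: the channels whose score is at most `d` in every ambiguous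
guessing game with `k` guessing rows. -/
def ambiguousPolytope (n n' k d : ℕ) : Set (Matrix (Fin n') (Fin n) ℝ) :=
  {P | P ∈ channels n n' ∧
    ∀ G : Matrix (Fin n') (Fin n) ℝ, IsAmbiguousGame k d G → matrixInner G P ≤ (d : ℝ)}

/-- The maximum likelihood polytope: the case where every row is a guessing row. -/
def mlPolytope (n n' d : ℕ) : Set (Matrix (Fin n') (Fin n) ℝ) :=
  ambiguousPolytope n n' n' d

/-!
To simulate `P` with one message less, split it into channels that waste one: couple every law
`P(·|x)` with a common label `l` and condition on `l`.

For `d = n' - 1` the label is a forbidden output `y`, of weight proportional to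
`1 - max_x P(y|x)`. The total weight is at least `1` on the maximum likelihood polytope, and this
is exactly what lets the label avoid the output: a coupling of two laws with `q y + p y ≤ 1` for
all `y` that has minimal trace vanishes on the diagonal, as otherwise diagonal mass could be
exchanged with off-diagonal mass.

For `d = n - 1` the label is an edge `{a, b}` of the complete graph on the inputs, which are then
merged. The edges are weighted by optimal fractional matchings with capacities `P(y|·)`, one for
each `y`; their total weight is `n` minus the best score of `P` in a game with ambiguous weight
`1 / 2`, hence at least `1`. Games with fewer than `n` guessing rows need no separate assumption,
because they never guess some input `x₀`, and are then controlled by pure guessing games.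

Conversely, a linear score is maximised over `R * T` by a deterministic decoder, which turns the
game on the outputs into a game on the messages.
-/

/-- `c` is a coupling of the nonnegative weights `q` and `p`: a transport plan, with marginals `q`
(row sums) and `p` (column sums). -/
structure IsCoupling {ι κ : Type*} [Fintype ι] [Fintype κ] (q : ι → ℝ) (p : κ → ℝ)
    (c : ι → κ → ℝ) : Prop where
  nonneg : ∀ a b, 0 ≤ c a b
  row_sum : ∀ a, ∑ b, c a b = q a
  col_sum : ∀ b, ∑ a, c a b = p b

section Coupling

variable {ι κ : Type*} [Fintype ι] [Fintype κ] {q : ι → ℝ} {p : κ → ℝ} {c : ι → κ → ℝ}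

theorem IsCoupling.eq_zero_of_row_eq_zero (hc : IsCoupling q p c) {a : ι} (ha : q a = 0) (b : κ) :
    c a b = 0 :=
  (Finset.sum_eq_zero_iff_of_nonneg fun b _ => hc.nonneg a b).1 ((hc.row_sum a).trans ha) b
    (Finset.mem_univ b)

theorem IsCoupling.le_row_sum (hc : IsCoupling q p c) (a : ι) (b : κ) : c a b ≤ q a :=
  (Finset.single_le_sum (fun b _ => hc.nonneg a b) (Finset.mem_univ b)).trans_eq (hc.row_sum a)

theorem exists_isCoupling (hq : ∀ a, 0 ≤ q a) (hp : ∀ b, 0 ≤ p b) (hqp : ∑ a, q a = ∑ b, p b) :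
    ∃ c, IsCoupling q p c := by
  refine ⟨fun a b => q a * p b / ∑ b, p b,
    fun a b => div_nonneg (mul_nonneg (hq a) (hp b)) (Finset.sum_nonneg fun b _ => hp b),
    fun a => ?_, fun b => ?_⟩
  · rw [← Finset.sum_div, ← Finset.mul_sum]
    refine mul_div_cancel_of_imp fun h => ?_
    rw [← hqp, Finset.sum_eq_zero_iff_of_nonneg fun a _ => hq a] at h
    exact h a (Finset.mem_univ a)
  · rw [← Finset.sum_div, ← Finset.sum_mul, hqp, mul_comm]
    refine mul_div_cancel_of_imp fun h => ?_
    rw [Finset.sum_eq_zero_iff_of_nonneg fun b _ => hp b] at h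
    exact h b (Finset.mem_univ b)

theorem exists_isCoupling_eqOn (hq : ∀ a, 0 ≤ q a) (hqp : ∑ a, q a = ∑ b, p b) (s : Finset ι)
    {w : ι → κ → ℝ} (hw : ∀ a ∈ s, ∀ b, 0 ≤ w a b) (hrow : ∀ a ∈ s, ∑ b, w a b = q a)
    (hcol : ∀ b, ∑ a ∈ s, w a b ≤ p b) :
    ∃ c, IsCoupling q p c ∧ Set.EqOn c w s := by
  classical
  let w' : ι → κ → ℝ := fun a b => if a ∈ s then w a b else 0
  let q' : ι → ℝ := fun a => if a ∈ s then 0 else q a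
  have sum_w' : ∀ b, ∑ a, w' a b = ∑ a ∈ s, w a b := fun b => by simp [w']
  have hq' : ∀ a, q' a + ∑ b, w' a b = q a := fun a => by
    by_cases ha : a ∈ s <;> simp [q', w', ha, hrow]
  have hmass : ∑ a, q' a = ∑ b, (p b - ∑ a ∈ s, w a b) := by
    simp_rw [Finset.sum_sub_distrib, ← hqp, ← hq', Finset.sum_add_distrib, ← sum_w']
    rw [Finset.sum_comm (f := w'), add_sub_cancel_right]
  obtain ⟨r, hr⟩ := exists_isCoupling (q := q') (p := fun b => p b - ∑ a ∈ s, w a b)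
    (fun a => by by_cases ha : a ∈ s <;> simp [q', ha, hq]) (fun b => sub_nonneg.2 (hcol b)) hmass
  refine ⟨fun a b => r a b + w' a b, ⟨fun a b => ?_, fun a => ?_, fun b => ?_⟩, fun a ha => ?_⟩
  · refine add_nonneg (hr.nonneg a b) ?_
    by_cases ha : a ∈ s <;> simp [w', ha, hw]
  · rw [Finset.sum_add_distrib, hr.row_sum, hq']
  · rw [Finset.sum_add_distrib, hr.col_sum, sum_w', sub_add_cancel]
  · funext b
    have ha' : a ∈ s := ha
    simp [w', ha', hr.eq_zero_of_row_eq_zero (show q' a = 0 from if_pos ha')]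

theorem isCompact_setOf_isCoupling (q : ι → ℝ) (p : κ → ℝ) : IsCompact {c | IsCoupling q p c} := by
  have hclosed : IsClosed {c : ι → κ → ℝ | IsCoupling q p c} := by
    have : {c : ι → κ → ℝ | IsCoupling q p c} =
        {c | (∀ a b, 0 ≤ c a b) ∧ (∀ a, ∑ b, c a b = q a) ∧ ∀ b, ∑ a, c a b = p b} :=
      Set.ext fun c => ⟨fun h => ⟨h.1, h.2, h.3⟩, fun h => ⟨h.1, h.2.1, h.2.2⟩⟩
    simp only [this, Set.ofPred_and, Set.ofPred_forall]
    refine .inter ?_ (.inter ?_ ?_)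
    · exact isClosed_iInter fun a => isClosed_iInter fun b =>
        isClosed_le continuous_const (by fun_prop)
    · exact isClosed_iInter fun a => isClosed_eq (by fun_prop) continuous_const
    · exact isClosed_iInter fun b => isClosed_eq (by fun_prop) continuous_const
  exact (isCompact_Icc (a := (0 : ι → κ → ℝ)) (b := fun a _ => q a)).of_isClosed_subset hclosed
    fun c hc => ⟨hc.nonneg, fun a b => hc.le_row_sum a b⟩

/-- The perturbation moves mass `ε` from `(i, j)` and `(a, b)` to `(i, b)` and `(a, j)`. -/
theorem IsCoupling.exchange [DecidableEq ι] [DecidableEq κ] (hc : IsCoupling q p c) {i a : ι}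
    {j b : κ} {ε : ℝ} (hε : 0 ≤ ε) (hij : ε ≤ c i j) (hab : ε ≤ c a b) :
    IsCoupling q p fun x y => c x y - ε *
      ((Pi.single i 1 - Pi.single a 1 : ι → ℝ) x * (Pi.single j 1 - Pi.single b 1 : κ → ℝ) y) := by
  refine ⟨fun x y => ?_, fun x => ?_, fun y => ?_⟩
  · have := hc.nonneg x y
    simp only [Pi.sub_apply, Pi.single_apply]
    split_ifs <;> subst_vars <;> simp <;> linarith
  · simp [← Finset.mul_sum, hc.row_sum]
  · simp [← Finset.mul_sum, ← Finset.sum_mul, hc.col_sum]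

theorem IsCoupling.add_eq_sum_add {q p : ι → ℝ} {c : ι → ι → ℝ} (hc : IsCoupling q p c) {i : ι}
    (hi : ∀ a ≠ i, ∀ b ≠ i, c a b = 0) : q i + p i = ∑ a, q a + c i i := by
  classical
  have hrow : ∀ a ∈ Finset.univ.erase i, q a = c a i := fun a ha => by
    rw [← hc.row_sum, Fintype.sum_eq_single i (hi a (Finset.ne_of_mem_erase ha))]
  rw [← Finset.add_sum_erase _ q (Finset.mem_univ i), Finset.sum_congr rfl hrow, ← hc.col_sum,
    ← Finset.add_sum_erase _ (fun a => c a i) (Finset.mem_univ i)]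
  ring

theorem exists_isCoupling_diag_eq_zero {q p : ι → ℝ} (hq : ∀ a, 0 ≤ q a) (hp : ∀ a, 0 ≤ p a)
    (hqp : ∑ a, q a = ∑ a, p a) (h : ∀ a, q a + p a ≤ ∑ a, q a) :
    ∃ c, IsCoupling q p c ∧ ∀ a, c a a = 0 := by
  classical
  obtain ⟨c, hc, hmin⟩ := (isCompact_setOf_isCoupling q p).exists_isMinOn
    (exists_isCoupling hq hp hqp) (f := fun c => ∑ a, c a a) (by fun_prop)
  refine ⟨c, hc, fun i => ?_⟩
  by_contra hi
  have hi : 0 < c i i := (hc.nonneg i i).lt_of_ne' hi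
  have hzero : ∀ a ≠ i, ∀ b ≠ i, c a b = 0 := by
    intro a ha b hb
    by_contra hab
    have hε : 0 < min (c i i) (c a b) := lt_min hi ((hc.nonneg a b).lt_of_ne' hab)
    have htrace : 1 ≤ ∑ x, (Pi.single i 1 - Pi.single a 1 : ι → ℝ) x *
        (Pi.single i 1 - Pi.single b 1 : ι → ℝ) x := by
      by_cases h : a = b <;>
        simp [sub_mul, Finset.sum_sub_distrib, Pi.single_apply, ha, hb, hb.symm, h]
    have hle := isMinOn_iff.1 hmin _ (hc.exchange hε.le (min_le_left _ _) (min_le_right _ _))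
    rw [Finset.sum_sub_distrib, ← Finset.mul_sum] at hle
    linarith [le_mul_of_one_le_right hε.le htrace]
  linarith [h i, hc.add_eq_sum_add hzero]

end Coupling

/-- `k` is a fractional matching of the complete graph on `ι` with vertex capacities `v`. The
undirected edge `{a, b}` carries the weight `k (a, b) + k (b, a)`, and there are no loops. -/
structure IsFractionalMatching {ι : Type*} [Fintype ι] [DecidableEq ι] (v : ι → ℝ)
    (k : ι × ι → ℝ) : Prop where
  nonneg : ∀ e, 0 ≤ k e
  diag_eq_zero : ∀ a, k (a, a) = 0
  load_le : ∀ x, ∑ e with x = e.1 ∨ x = e.2, k e ≤ v x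

section Matching

variable {ι : Type*} [Fintype ι] [DecidableEq ι] {v : ι → ℝ} {k : ι × ι → ℝ}

theorem sum_incident_eq_of_diag_eq_zero (hk : ∀ a, k (a, a) = 0) (x : ι) :
    ∑ e with x = e.1 ∨ x = e.2, k e = ∑ b, k (x, b) + ∑ a, k (a, x) := by
  have split : ∀ a b, (if x = a ∨ x = b then k (a, b) else 0) =
      (if x = a then k (a, b) else 0) + if x = b then k (a, b) else 0 := by
    intro a b
    rcases eq_or_ne x a with rfl | ha <;> rcases eq_or_ne x b with rfl | hb <;> simp [*]
  simp only [Finset.sum_filter, Fintype.sum_prod_type, split, Finset.sum_add_distrib]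
  congr 1
  · rw [Finset.sum_comm]
    simp
  · simp

theorem IsFractionalMatching.smul (hk : IsFractionalMatching v k) {r : ℝ} (hr0 : 0 ≤ r)
    (hr1 : r ≤ 1) : IsFractionalMatching v (r • k) where
  nonneg e := mul_nonneg hr0 (hk.nonneg e)
  diag_eq_zero a := by simp [hk.diag_eq_zero]
  load_le x := by
    simp only [Pi.smul_apply, smul_eq_mul, ← Finset.mul_sum]
    exact (mul_le_of_le_one_left (Finset.sum_nonneg fun e _ => hk.nonneg e) hr1).trans
      (hk.load_le x)

theorem exists_isFractionalMatching_sum_eq_half (hv : ∀ x, 0 ≤ v x)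
    (h : ∀ x, 2 * v x ≤ ∑ x, v x) :
    ∃ k, IsFractionalMatching v k ∧ ∑ e, k e = 1 / 2 * ∑ x, v x := by
  obtain ⟨c, hc, hdiag⟩ := exists_isCoupling_diag_eq_zero hv hv rfl fun x => by linarith [h x]
  refine ⟨fun e => 1 / 2 * c e.1 e.2, ⟨fun e => ?_, fun a => by simp [hdiag], fun x => ?_⟩, ?_⟩
  · exact mul_nonneg (by norm_num) (hc.nonneg _ _)
  · rw [sum_incident_eq_of_diag_eq_zero fun a => by simp [hdiag]]
    simp only [← Finset.mul_sum, hc.row_sum, hc.col_sum]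
    linarith
  · simp only [Fintype.sum_prod_type, ← Finset.mul_sum, hc.row_sum]

theorem exists_isFractionalMatching_star (hv : ∀ x, 0 ≤ v x) {x₀ : ι}
    (h : ∑ x, v x ≤ 2 * v x₀) :
    ∃ k, IsFractionalMatching v k ∧ ∑ e, k e = ∑ x, v x - v x₀ := by
  let leaf : ι → ℝ := fun b => if b = x₀ then 0 else v b
  have leaf_nonneg : ∀ b, 0 ≤ leaf b := fun b => by by_cases hb : b = x₀ <;> simp [leaf, hb, hv]
  have sum_leaf : ∑ b, leaf b = ∑ x, v x - v x₀ := by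
    rw [← Finset.sum_erase_eq_sub (Finset.mem_univ x₀), ← Finset.filter_ne', Finset.sum_filter]
    exact Finset.sum_congr rfl fun b _ => (ite_not ..).symm
  refine ⟨fun e => if e.1 = x₀ then leaf e.2 else 0, ⟨fun e => ?_, fun a => ?_, fun x => ?_⟩, ?_⟩
  · by_cases he : e.1 = x₀ <;> simp [he, leaf_nonneg]
  · by_cases ha : a = x₀ <;> simp [ha, leaf]
  · rw [sum_incident_eq_of_diag_eq_zero fun a => by by_cases ha : a = x₀ <;> simp [ha, leaf]]
    by_cases hx : x = x₀
    · have hcenter : ∑ a, (if a = x₀ then leaf x₀ else 0) = 0 := by simp [leaf]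
      simp only [hx, if_true, sum_leaf, hcenter]
      linarith
    · simp [hx, leaf]
  · simp [Fintype.sum_prod_type_right, sum_leaf]

/-- The optimum is half of the capacity, unless a single vertex `x` (the case `o = some x`) holds
more than half of it. -/
theorem exists_isFractionalMatching (hv : ∀ x, 0 ≤ v x) :
    ∃ k, ∃ o : Option ι, IsFractionalMatching v k ∧
      ∑ e, k e = ∑ x, v x - o.elim (1 / 2 * ∑ x, v x) v := by
  by_cases h : ∀ x, 2 * v x ≤ ∑ x, v x
  · obtain ⟨k, hk, hsum⟩ := exists_isFractionalMatching_sum_eq_half hv h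
    exact ⟨k, none, hk, by rw [hsum, Option.elim_none]; ring⟩
  · push Not at h
    obtain ⟨x₀, hx₀⟩ := h
    obtain ⟨k, hk, hsum⟩ := exists_isFractionalMatching_star hv hx₀.le
    exact ⟨k, some x₀, hk, hsum⟩

end Matching

section Channel

variable {n n' d m : ℕ} {P : Matrix (Fin n') (Fin n) ℝ}

theorem channels_apply_le_one (hP : P ∈ channels n n') (y : Fin n') (x : Fin n) : P y x ≤ 1 :=
  (Finset.single_le_sum (fun y _ => hP.1 y x) (Finset.mem_univ y)).trans_eq (hP.2 x)

theorem sum_sum_of_mem_channels (hP : P ∈ channels n n') : ∑ y, ∑ x, P y x = n :=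
  Finset.sum_comm.trans (by simp [hP.2])

theorem sum_apply_le_of_mem_channels (hP : P ∈ channels n n') (g : Fin n' → Fin n) :
    ∑ y, P y (g y) ≤ n' :=
  (Finset.sum_le_sum fun y _ => channels_apply_le_one hP y (g y)).trans_eq (by simp)

theorem convex_channels (n n' : ℕ) : Convex ℝ (channels n n') := by
  intro P hP Q hQ a b ha hb hab
  refine ⟨fun y x => ?_, fun x => ?_⟩
  · exact add_nonneg (mul_nonneg ha (hP.1 y x)) (mul_nonneg hb (hQ.1 y x))
  · simp [Finset.sum_add_distrib, ← Finset.mul_sum, hP.2, hQ.2, hab]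

theorem mul_mem_channels {R : Matrix (Fin n') (Fin d) ℝ} {T : Matrix (Fin d) (Fin n) ℝ}
    (hR : R ∈ channels d n') (hT : T ∈ channels n d) : R * T ∈ channels n n' := by
  refine ⟨fun y x => ?_, fun x => ?_⟩
  · rw [Matrix.mul_apply]
    exact Finset.sum_nonneg fun m _ => mul_nonneg (hR.1 y m) (hT.1 m x)
  · simp only [Matrix.mul_apply]
    rw [Finset.sum_comm]
    simp [← Finset.sum_mul, hR.2, hT.2]

theorem signalingPolytope_eq_convexHull (n n' d : ℕ) :
    signalingPolytope n n' d =
      convexHull ℝ (Set.image2 (· * ·) (channels d n') (channels n d)) := by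
  ext P
  constructor
  · rintro ⟨-, L, q, T, R, hq, hq1, hT, hR, hP⟩
    refine mem_convexHull_of_exists_fintype q (fun l => R l * T l) hq hq1
      (fun l => Set.mem_image2_of_mem (hR l) (hT l)) ?_
    ext y x
    simp [hP, Matrix.sum_apply, Matrix.mul_apply]
  · intro hP
    refine ⟨convexHull_min ?_ (convex_channels n n') hP, ?_⟩
    · rintro _ ⟨R, hR, T, hT, rfl⟩
      exact mul_mem_channels hR hT
    · obtain ⟨ι, _, q, W, hq, hq1, hW, rfl⟩ := mem_convexHull_iff_exists_fintype.1 hP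
      choose R hR T hT hRT using hW
      let e := (Fintype.equivFin ι).symm
      refine ⟨Fintype.card ι, q ∘ e, T ∘ e, R ∘ e, fun l => hq _, (e.sum_comp q).trans hq1,
        fun l => hT _, fun l => hR _, fun y x => ?_⟩
      simp only [Function.comp_apply, ← Matrix.mul_apply]
      rw [e.sum_comp (fun i => q i * (R i * T i) y x)]
      simp [← hRT, Matrix.sum_apply]

theorem mul_mem_signalingPolytope {R : Matrix (Fin n') (Fin d) ℝ} {T : Matrix (Fin d) (Fin n) ℝ}
    (hR : R ∈ channels d n') (hT : T ∈ channels n d) : R * T ∈ signalingPolytope n n' d := by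
  rw [signalingPolytope_eq_convexHull]
  exact subset_convexHull ℝ _ (Set.mem_image2_of_mem hR hT)

theorem mem_signalingPolytope_of_row_eq_zero {W : Matrix (Fin (d + 1)) (Fin n) ℝ}
    (hW : W ∈ channels n (d + 1)) {z : Fin (d + 1)} (hz : ∀ x, W z x = 0) :
    W ∈ signalingPolytope n (d + 1) d := by
  let R : Matrix (Fin (d + 1)) (Fin d) ℝ := Matrix.of fun y m => if y = z.succAbove m then 1 else 0
  have hR : R ∈ channels d (d + 1) :=
    ⟨fun y m => by by_cases h : y = z.succAbove m <;> simp [R, h], fun m => by simp [R]⟩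
  have hT : W.submatrix z.succAbove id ∈ channels n d := by
    refine ⟨fun _ _ => hW.1 _ _, fun x => ?_⟩
    simpa [Fin.sum_univ_succAbove _ z, hz] using hW.2 x
  convert mul_mem_signalingPolytope hR hT using 1
  ext y x
  rcases Fin.eq_self_or_eq_succAbove z y with rfl | ⟨m, rfl⟩
  · simp [R, Matrix.mul_apply, hz, (Fin.succAbove_ne _ _).symm]
  · simp [R, Matrix.mul_apply]

theorem mem_signalingPolytope_of_col_eq {W : Matrix (Fin n') (Fin (d + 1)) ℝ}
    (hW : W ∈ channels (d + 1) n') {a b : Fin (d + 1)} (hab : a ≠ b) (h : ∀ y, W y a = W y b) :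
    W ∈ signalingPolytope (d + 1) n' d := by
  have merge : ∀ x : Fin (d + 1), ∃ m : Fin d, ∀ y, W y (b.succAbove m) = W y x := by
    intro x
    rcases Fin.eq_self_or_eq_succAbove b x with rfl | ⟨m, rfl⟩
    · obtain ⟨m, rfl⟩ := Fin.exists_succAbove_eq hab
      exact ⟨m, h⟩
    · exact ⟨m, fun _ => rfl⟩
  choose f hf using merge
  let T : Matrix (Fin d) (Fin (d + 1)) ℝ := Matrix.of fun m x => if m = f x then 1 else 0
  have hT : T ∈ channels (d + 1) d :=
    ⟨fun m x => by by_cases h : m = f x <;> simp [T, h], fun x => by simp [T]⟩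
  have hR : W.submatrix id b.succAbove ∈ channels d n' :=
    ⟨fun _ _ => hW.1 _ _, fun m => hW.2 _⟩
  convert mul_mem_signalingPolytope hR hT using 1
  ext y x
  simp [T, Matrix.mul_apply, hf]

end Channel

/-- The law of the output `y` given the input `x` and the label `l`, when the label is coupled with
the output by `c x` for every input `x`, and has law `q`. It is junk where `q l = 0`. -/
noncomputable def conditionalChannel {ι : Type*} {n n' : ℕ} (q : ι → ℝ)
    (c : Fin n → ι → Fin n' → ℝ) (l : ι) : Matrix (Fin n') (Fin n) ℝ :=
  Matrix.of fun y x => c x l y / q l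

section ConditionalChannel

variable {ι : Type*} [Fintype ι] {n n' d : ℕ} {P : Matrix (Fin n') (Fin n) ℝ} {q : ι → ℝ}
  {c : Fin n → ι → Fin n' → ℝ}

theorem conditionalChannel_mem_channels (hc : ∀ x, IsCoupling q (P.col x) (c x)) {l : ι}
    (hl : 0 < q l) : conditionalChannel q c l ∈ channels n n' := by
  refine ⟨fun y x => div_nonneg ((hc x).nonneg l y) hl.le, fun x => ?_⟩
  simp [conditionalChannel, ← Finset.sum_div, (hc x).row_sum, hl.ne']

theorem sum_smul_conditionalChannel (hc : ∀ x, IsCoupling q (P.col x) (c x)) :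
    ∑ l, q l • conditionalChannel q c l = P := by
  ext y x
  simp only [Matrix.sum_apply, Matrix.smul_apply, conditionalChannel, Matrix.of_apply, smul_eq_mul]
  rw [← Matrix.col_apply P x y, ← (hc x).col_sum y]
  exact Finset.sum_congr rfl fun l _ =>
    mul_div_cancel_of_imp' fun h => (hc x).eq_zero_of_row_eq_zero h y

theorem mem_signalingPolytope_of_conditionalChannel (hq : ∀ l, 0 ≤ q l) (hq1 : ∑ l, q l = 1)
    (hc : ∀ x, IsCoupling q (P.col x) (c x))
    (h : ∀ l, conditionalChannel q c l ∈ channels n n' →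
      conditionalChannel q c l ∈ signalingPolytope n n' d) :
    P ∈ signalingPolytope n n' d := by
  rw [← sum_smul_conditionalChannel hc, ← finsum_eq_sum_of_fintype]
  refine Convex.finsum_mem ?_ hq (by rwa [finsum_eq_sum_of_fintype]) fun l hl =>
    h l (conditionalChannel_mem_channels hc ((hq l).lt_of_ne' hl))
  rw [signalingPolytope_eq_convexHull]
  exact convex_convexHull ℝ _

end ConditionalChannel

/-- The game in which the output `y` is answered by the guess `g y`; the value `none` stands for an
ambiguous row, all of whose entries are `w`. -/
def guessMatrix {n n' : ℕ} (w : ℝ) (g : Fin n' → Option (Fin n)) : Matrix (Fin n') (Fin n) ℝ :=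
  Matrix.of fun y x => (g y).elim w fun a => if x = a then 1 else 0

section Game

variable {n n' d m k : ℕ} {P : Matrix (Fin n') (Fin n) ℝ}

theorem matrixInner_guessMatrix (w : ℝ) (g : Fin n' → Option (Fin n))
    (P : Matrix (Fin n') (Fin n) ℝ) :
    matrixInner (guessMatrix w g) P = ∑ y, (g y).elim (w * ∑ x, P y x) (P y) := by
  rw [matrixInner, Finset.sum_comm]
  refine Finset.sum_congr rfl fun y _ => ?_
  rcases h : g y with _ | a <;> simp [guessMatrix, h, Finset.mul_sum]

theorem exists_eq_ite_of_sum_eq_one {ι : Type*} [Fintype ι] [DecidableEq ι] {r : ι → ℝ}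
    (h01 : ∀ x, r x = 0 ∨ r x = 1) (hsum : ∑ x, r x = 1) :
    ∃ a, ∀ x, r x = if x = a then 1 else 0 := by
  classical
  have indicator : ∀ x, r x = if r x = 1 then 1 else 0 := fun x => by
    rcases h01 x with h | h <;> simp [h]
  rw [Finset.sum_congr rfl fun x _ => indicator x, Finset.sum_boole] at hsum
  obtain ⟨a, ha⟩ := Finset.card_eq_one.1 (Nat.cast_eq_one.1 hsum)
  refine ⟨a, fun x => ?_⟩
  have hx : r x = 1 ↔ x = a := by simpa using Finset.ext_iff.1 ha x
  rw [indicator x]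
  exact if_congr hx rfl rfl

theorem isAmbiguousGame_iff {G : Matrix (Fin n') (Fin n) ℝ} :
    IsAmbiguousGame k d G ↔ ∃ g : Fin n' → Option (Fin n),
      ({y | (g y).isSome} : Finset (Fin n')).card = k ∧
        G = guessMatrix (1 / ((n : ℝ) - d + 1)) g := by
  constructor
  · rintro ⟨S, hS, hguess, hambiguous⟩
    have row : ∀ y, ∃ o : Option (Fin n), (o.isSome ↔ y ∈ S) ∧
        ∀ x, G y x = o.elim (1 / ((n : ℝ) - d + 1)) fun a => if x = a then 1 else 0 := by
      intro y
      by_cases hy : y ∈ S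
      · obtain ⟨a, ha⟩ := exists_eq_ite_of_sum_eq_one (hguess y hy).1 (hguess y hy).2
        exact ⟨some a, by simp [hy], ha⟩
      · exact ⟨none, by simp [hy], hambiguous y hy⟩
    choose g hgS hg using row
    exact ⟨g, by simp [hgS, hS], Matrix.ext hg⟩
  · rintro ⟨g, hg, rfl⟩
    refine ⟨_, hg, fun y hy => ?_, fun y hy x => ?_⟩
    · obtain ⟨a, ha⟩ := Option.isSome_iff_exists.1 (Finset.mem_filter.1 hy).2
      exact ⟨fun x => by by_cases hx : x = a <;> simp [guessMatrix, ha, hx],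
        by simp [guessMatrix, ha]⟩
    · have hy' : g y = none := by simpa using hy
      simp [guessMatrix, hy']

theorem mem_ambiguousPolytope_iff :
    P ∈ ambiguousPolytope n n' k d ↔ P ∈ channels n n' ∧
      ∀ g : Fin n' → Option (Fin n), ({y | (g y).isSome} : Finset (Fin n')).card = k →
        matrixInner (guessMatrix (1 / ((n : ℝ) - d + 1)) g) P ≤ d := by
  refine and_congr_right fun _ => ⟨fun h g hg => h _ (isAmbiguousGame_iff.2 ⟨g, hg, rfl⟩), ?_⟩
  rintro h G hG
  obtain ⟨g, hg, rfl⟩ := isAmbiguousGame_iff.1 hG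
  exact h g hg

theorem mem_ambiguousPolytope_succ_iff {P : Matrix (Fin n') (Fin (d + 1)) ℝ} :
    P ∈ ambiguousPolytope (d + 1) n' k d ↔ P ∈ channels (d + 1) n' ∧
      ∀ g : Fin n' → Option (Fin (d + 1)), ({y | (g y).isSome} : Finset (Fin n')).card = k →
        matrixInner (guessMatrix (1 / 2) g) P ≤ d := by
  have hw : ((d + 1 : ℕ) : ℝ) - d + 1 = 2 := by
    push_cast
    ring
  rw [mem_ambiguousPolytope_iff, hw]

theorem mem_mlPolytope_iff :
    P ∈ mlPolytope n n' d ↔ P ∈ channels n n' ∧ ∀ g : Fin n' → Fin n, ∑ y, P y (g y) ≤ d := by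
  rw [mlPolytope, mem_ambiguousPolytope_iff]
  refine and_congr_right fun _ => ⟨fun h g => ?_, fun h g hg => ?_⟩
  · simpa [matrixInner_guessMatrix] using h (some ∘ g) (by simp)
  · have hsome : ∀ y, ∃ a, g y = some a := fun y => by
      have huniv := (Finset.card_eq_iff_eq_univ _).1 (hg.trans (Fintype.card_fin n').symm)
      simpa [Option.isSome_iff_exists] using Finset.eq_univ_iff_forall.1 huniv y
    choose a ha using hsome
    simpa [matrixInner_guessMatrix, ha] using h a

theorem mlPolytope_eq_setOf_sum_iSup_le (hn : 0 < n) :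
    mlPolytope n n' d = {P | P ∈ channels n n' ∧ ∑ y, (⨆ x, P y x) ≤ (d : ℝ)} := by
  have : Nonempty (Fin n) := ⟨⟨0, hn⟩⟩
  ext P
  refine mem_mlPolytope_iff.trans (and_congr_right fun _ => ⟨fun h => ?_, fun h g => ?_⟩)
  · choose g hg using fun y => exists_eq_ciSup_of_finite (f := P y)
    simpa [hg] using h g
  · exact (Finset.sum_le_sum fun y _ => le_ciSup (Set.finite_range (P y)).bddAbove (g y)).trans h

theorem isLinearMap_matrixInner (G : Matrix (Fin n') (Fin n) ℝ) :
    IsLinearMap ℝ (matrixInner G) where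
  map_add P Q := by simp [matrixInner, mul_add, Finset.sum_add_distrib]
  map_smul r P := by simp [matrixInner, mul_left_comm _ r, Finset.mul_sum]

theorem matrixInner_eq_trace (G P : Matrix (Fin n') (Fin n) ℝ) :
    matrixInner G P = (G * P.transpose).trace :=
  Finset.sum_comm

theorem matrixInner_mul (G : Matrix (Fin n') (Fin n) ℝ) (R : Matrix (Fin n') (Fin m) ℝ)
    (T : Matrix (Fin m) (Fin n) ℝ) :
    matrixInner G (R * T) = matrixInner (G * T.transpose) R := by
  rw [matrixInner_eq_trace, matrixInner_eq_trace, Matrix.transpose_mul, Matrix.mul_assoc]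

/-- Decoding the message `a` as the output `f a` with the best score is at least as good as
decoding it at random. -/
theorem exists_matrixInner_mul_le (G : Matrix (Fin n') (Fin n) ℝ) {R : Matrix (Fin n') (Fin m) ℝ}
    (hR : R ∈ channels m n') (T : Matrix (Fin m) (Fin n) ℝ) :
    ∃ f : Fin m → Fin n', matrixInner G (R * T) ≤ matrixInner (G.submatrix f id) T := by
  let score : Matrix (Fin n') (Fin m) ℝ := G * T.transpose
  have best : ∀ a, ∃ y, ∑ z, score z a * R z a ≤ score y a := by
    intro a
    obtain ⟨z, -, -⟩ := Finset.exists_ne_zero_of_sum_ne_zero (hR.2 a ▸ one_ne_zero)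
    have : Nonempty (Fin n') := ⟨z⟩
    obtain ⟨y, hy⟩ := Finite.exists_max fun y => score y a
    refine ⟨y, ?_⟩
    calc ∑ z, score z a * R z a ≤ ∑ z, score y a * R z a :=
          Finset.sum_le_sum fun z _ => mul_le_mul_of_nonneg_right (hy z) (hR.1 z a)
      _ = score y a := by rw [← Finset.mul_sum, hR.2, mul_one]
  choose f hf using best
  refine ⟨f, ?_⟩
  calc matrixInner G (R * T) = ∑ a, ∑ z, score z a * R z a := matrixInner_mul G R T
    _ ≤ ∑ a, score (f a) a := Finset.sum_le_sum fun a _ => hf a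
    _ = matrixInner (G.submatrix f id) T := (matrixInner_eq_trace _ _).symm

theorem matrixInner_le_of_mem_signalingPolytope (hP : P ∈ signalingPolytope n n' m)
    {G : Matrix (Fin n') (Fin n) ℝ} {C : ℝ}
    (h : ∀ f : Fin m → Fin n', ∀ T ∈ channels n m, matrixInner (G.submatrix f id) T ≤ C) :
    matrixInner G P ≤ C := by
  rw [signalingPolytope_eq_convexHull] at hP
  refine convexHull_min ?_ (convex_halfSpace_le (isLinearMap_matrixInner G) C) hP
  rintro _ ⟨R, hR, T, hT, rfl⟩
  obtain ⟨f, hf⟩ := exists_matrixInner_mul_le G hR T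
  exact hf.trans (h f T hT)

end Game

section MaximumLikelihood

variable {n n' d m : ℕ}

theorem signalingPolytope_subset_mlPolytope (hm : m ≤ d) :
    signalingPolytope n n' m ⊆ mlPolytope n n' d := by
  refine fun P hP => mem_mlPolytope_iff.2 ⟨hP.1, fun g => ?_⟩
  have hguess : matrixInner (guessMatrix 0 (some ∘ g)) P ≤ m :=
    matrixInner_le_of_mem_signalingPolytope hP fun f T hT =>
      (matrixInner_guessMatrix 0 (some ∘ g ∘ f) T).trans_le
        (sum_apply_le_of_mem_channels hT (g ∘ f))
  rw [matrixInner_guessMatrix] at hguess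
  exact hguess.trans (Nat.cast_le.2 hm)

theorem mlPolytope_subset_signalingPolytope (hn : 0 < n) :
    mlPolytope n (d + 1) d ⊆ signalingPolytope n (d + 1) d := by
  rw [mlPolytope_eq_setOf_sum_iSup_le hn]
  rintro P ⟨hP, hsup⟩
  have : Nonempty (Fin n) := ⟨⟨0, hn⟩⟩
  let v : Fin (d + 1) → ℝ := fun y => 1 - ⨆ x, P y x
  let s : ℝ := ∑ y, v y
  have hv : ∀ y, 0 ≤ v y := fun y => sub_nonneg.2 (ciSup_le (channels_apply_le_one hP y))
  have hs : 1 ≤ s := by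
    have : s = d + 1 - ∑ y, ⨆ x, P y x := by simp [s, v]
    linarith
  have hs0 : 0 < s := zero_lt_one.trans_le hs
  have hq : ∀ y, 0 ≤ v y / s := fun y => div_nonneg (hv y) hs0.le
  have hq1 : ∑ y, v y / s = 1 := by rw [← Finset.sum_div, div_self hs0.ne']
  have coupling : ∀ x, ∃ c, IsCoupling (fun y => v y / s) (P.col x) c ∧ ∀ y, c y y = 0 := by
    refine fun x => exists_isCoupling_diag_eq_zero hq (fun y => hP.1 y x)
      (hq1.trans (hP.2 x).symm) fun y => ?_
    have hle : P y x ≤ ⨆ x, P y x := le_ciSup (Set.finite_range (P y)).bddAbove x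
    calc v y / s + P y x ≤ v y + ⨆ x, P y x := add_le_add (div_le_self (hv y) hs) hle
      _ = ∑ y, v y / s := by rw [sub_add_cancel, hq1]
  choose c hc hdiag using coupling
  exact mem_signalingPolytope_of_conditionalChannel hq hq1 hc fun y hy =>
    mem_signalingPolytope_of_row_eq_zero hy (z := y) fun x => by simp [conditionalChannel, hdiag]

end MaximumLikelihood

section Ambiguous

variable {n n' d m : ℕ}

theorem exists_forall_ne_some_of_card_lt {g : Fin n' → Option (Fin n)}
    (hg : ({y | (g y).isSome} : Finset (Fin n')).card < n) : ∃ x, ∀ y, g y ≠ some x := by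
  by_contra! h
  choose s hs using h
  have hinj : Function.Injective s := fun x x' hx =>
    Option.some_injective _ ((hs x).symm.trans (hx ▸ hs x'))
  have hle := Finset.card_le_card_of_injOn (s := Finset.univ) (t := {y | (g y).isSome}) s
    (fun x _ => by simp [hs]) hinj.injOn
  rw [Finset.card_univ, Fintype.card_fin] at hle
  exact hle.not_gt hg

/-- The game is dominated by the average of two games: the pure guessing game that answers `x₀` on
the ambiguous outputs, and the one that wins whenever the input is not `x₀`. -/
theorem matrixInner_guessMatrix_half_le {P : Matrix (Fin n') (Fin n) ℝ} (hP : P ∈ channels n n')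
    (hguess : ∀ g : Fin n' → Fin n, ∑ y, P y (g y) ≤ (n : ℝ) - 1) {g : Fin n' → Option (Fin n)}
    {x₀ : Fin n} (hg : ∀ y, g y ≠ some x₀) :
    matrixInner (guessMatrix (1 / 2) g) P ≤ (n : ℝ) - 1 := by
  have hother : ∑ y, (∑ x, P y x - P y x₀) = (n : ℝ) - 1 := by
    rw [Finset.sum_sub_distrib, sum_sum_of_mem_channels hP, hP.2]
  have hrow : ∀ y, (g y).elim (1 / 2 * ∑ x, P y x) (P y) ≤
      1 / 2 * (P y ((g y).getD x₀) + (∑ x, P y x - P y x₀)) := by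
    intro y
    rcases h : g y with _ | a
    · simp
    · have ha : a ≠ x₀ := fun hax => hg y (hax ▸ h)
      have : P y a + P y x₀ ≤ ∑ x, P y x :=
        Finset.add_le_sum (fun x _ => hP.1 y x) (Finset.mem_univ a) (Finset.mem_univ x₀) ha
      simp only [Option.elim_some, Option.getD_some]
      linarith
  calc matrixInner (guessMatrix (1 / 2) g) P
      ≤ ∑ y, 1 / 2 * (P y ((g y).getD x₀) + (∑ x, P y x - P y x₀)) :=
        (matrixInner_guessMatrix _ _ _).trans_le (Finset.sum_le_sum fun y _ => hrow y)
    _ = 1 / 2 * (∑ y, P y ((g y).getD x₀) + ((n : ℝ) - 1)) := by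
        rw [← Finset.mul_sum, Finset.sum_add_distrib, hother]
    _ ≤ (n : ℝ) - 1 := by linarith [hguess fun y => (g y).getD x₀]

theorem sum_apply_le_sub_one_of_lt {P : Matrix (Fin n') (Fin n) ℝ} (hP : P ∈ channels n n')
    (h : n' < n) (g : Fin n' → Fin n) : ∑ y, P y (g y) ≤ (n : ℝ) - 1 := by
  have hcast : (n' : ℝ) + 1 ≤ n := mod_cast h
  linarith [sum_apply_le_of_mem_channels hP g]

theorem signalingPolytope_subset_ambiguousPolytope (hm : m ≤ d) (k : ℕ) :
    signalingPolytope (d + 1) n' m ⊆ ambiguousPolytope (d + 1) n' k d := by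
  refine fun P hP => mem_ambiguousPolytope_succ_iff.2 ⟨hP.1, fun g _ => ?_⟩
  refine matrixInner_le_of_mem_signalingPolytope hP fun f T hT => ?_
  have hcard : ({a | (g (f a)).isSome} : Finset (Fin m)).card < d + 1 :=
    ((Finset.card_le_univ _).trans_eq (Fintype.card_fin m)).trans_lt (Nat.lt_succ_of_le hm)
  obtain ⟨x₀, hx₀⟩ := exists_forall_ne_some_of_card_lt hcard
  calc matrixInner (guessMatrix (1 / 2) (g ∘ f)) T ≤ ((d + 1 : ℕ) : ℝ) - 1 :=
        matrixInner_guessMatrix_half_le hT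
          (sum_apply_le_sub_one_of_lt hT (Nat.lt_succ_of_le hm)) hx₀
    _ = d := by simp

theorem matrixInner_guessMatrix_half_le_of_forall_mem_ambiguousPolytope
    {P : Matrix (Fin n') (Fin (d + 1)) ℝ} (hP : P ∈ channels (d + 1) n')
    (h : ∀ k, d + 1 ≤ k → k ≤ n' → P ∈ ambiguousPolytope (d + 1) n' k d)
    (g : Fin n' → Option (Fin (d + 1))) : matrixInner (guessMatrix (1 / 2) g) P ≤ d := by
  rcases le_or_gt (d + 1) ({y | (g y).isSome} : Finset (Fin n')).card with hg | hg
  · exact (mem_ambiguousPolytope_succ_iff.1 (h _ hg (card_finset_fin_le _))).2 g rfl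
  · obtain ⟨x₀, hx₀⟩ := exists_forall_ne_some_of_card_lt hg
    have hguess : ∀ g : Fin n' → Fin (d + 1), ∑ y, P y (g y) ≤ ((d + 1 : ℕ) : ℝ) - 1 := by
      rcases le_or_gt (d + 1) n' with hn | hn
      · simpa using (mem_mlPolytope_iff.1 (h n' hn le_rfl)).2
      · exact sum_apply_le_sub_one_of_lt hP hn
    simpa using matrixInner_guessMatrix_half_le hP hguess hx₀

/-- The label is an edge `{a, b}`, under which the inputs `a` and `b` have the same output law. -/
theorem mem_signalingPolytope_of_isFractionalMatching {P : Matrix (Fin n') (Fin (d + 1)) ℝ}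
    (hP : P ∈ channels (d + 1) n') {k : Fin n' → Fin (d + 1) × Fin (d + 1) → ℝ}
    (hk : ∀ y, IsFractionalMatching (P y) (k y)) (hk1 : ∑ y, ∑ e, k y e = 1) :
    P ∈ signalingPolytope (d + 1) n' d := by
  let q : Fin (d + 1) × Fin (d + 1) → ℝ := fun e => ∑ y, k y e
  have hq : ∀ e, 0 ≤ q e := fun e => Finset.sum_nonneg fun y _ => (hk y).nonneg e
  have hq1 : ∑ e, q e = 1 := Finset.sum_comm.trans hk1
  choose c hc hck using fun x => exists_isCoupling_eqOn (p := P.col x) hq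
    (hq1.trans (hP.2 x).symm) {e | x = e.1 ∨ x = e.2} (w := fun e y => k y e)
    (fun e _ y => (hk y).nonneg e) (fun _ _ => rfl) fun y => (hk y).load_le x
  refine mem_signalingPolytope_of_conditionalChannel hq hq1 hc fun e he => ?_
  have hne : e.1 ≠ e.2 := by
    intro h
    have hqe : q e = 0 := Finset.sum_eq_zero fun y _ => by
      rw [show e = (e.1, e.1) from Prod.ext rfl h.symm, (hk y).diag_eq_zero]
    simpa [conditionalChannel, hqe] using he.2 0
  refine mem_signalingPolytope_of_col_eq he hne fun y => ?_
  have h1 : c e.1 e = fun y => k y e := hck e.1 (by simp)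
  have h2 : c e.2 e = fun y => k y e := hck e.2 (by simp)
  simp only [conditionalChannel, Matrix.of_apply, h1, h2]

theorem mem_signalingPolytope_of_matrixInner_guessMatrix_half_le
    {P : Matrix (Fin n') (Fin (d + 1)) ℝ} (hP : P ∈ channels (d + 1) n')
    (h : ∀ g, matrixInner (guessMatrix (1 / 2) g) P ≤ d) : P ∈ signalingPolytope (d + 1) n' d := by
  choose k g hk hsum using fun y => exists_isFractionalMatching (hP.1 y)
  let s : ℝ := ∑ y, ∑ e, k y e
  have hs : 1 ≤ s := by
    have hscore : s = (d + 1 : ℕ) - matrixInner (guessMatrix (1 / 2) g) P := by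
      rw [matrixInner_guessMatrix, ← sum_sum_of_mem_channels hP, ← Finset.sum_sub_distrib]
      exact Finset.sum_congr rfl fun y _ => hsum y
    push_cast at hscore
    linarith [h g]
  have hs0 : 0 < s := zero_lt_one.trans_le hs
  refine mem_signalingPolytope_of_isFractionalMatching hP
    (fun y => (hk y).smul (inv_nonneg.2 hs0.le) (inv_le_one_of_one_le₀ hs)) ?_
  simp only [Pi.smul_apply, smul_eq_mul, ← Finset.mul_sum]
  exact inv_mul_cancel₀ hs0.ne'

theorem mem_signalingPolytope_of_forall_mem_ambiguousPolytope {P : Matrix (Fin n') (Fin (d + 1)) ℝ}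
    (hP : P ∈ channels (d + 1) n')
    (h : ∀ k, d + 1 ≤ k → k ≤ n' → P ∈ ambiguousPolytope (d + 1) n' k d) :
    P ∈ signalingPolytope (d + 1) n' d :=
  mem_signalingPolytope_of_matrixInner_guessMatrix_half_le hP
    (matrixInner_guessMatrix_half_le_of_forall_mem_ambiguousPolytope hP h)

end Ambiguous

theorem theorem1 (n n' d : ℕ) (hn : 0 < n) (hn' : 0 < n') (hd : 0 < d) :
    (d + 1 = n' →
      signalingPolytope n n' d = mlPolytope n n' d ∧
      mlPolytope n n' d = {P | P ∈ channels n n' ∧ ∑ y, (⨆ x, P y x) ≤ (d : ℝ)} ∧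
      ∀ P ∈ channels n n',
        (∃ m, 0 < m ∧ m < n' ∧ P ∈ signalingPolytope n n' m) ↔ P ∈ mlPolytope n n' d) ∧
    (d + 1 = n →
      signalingPolytope n n' d =
        channels n n' ∩ ⋂ k ∈ Set.Icc n n', ambiguousPolytope n n' k d ∧
      ∀ P ∈ channels n n',
        (∃ m, 0 < m ∧ m < n ∧ P ∈ signalingPolytope n n' m) ↔
          ∀ k, n ≤ k → k ≤ n' → P ∈ ambiguousPolytope n n' k d) := by
  constructor
  · rintro rfl
    have heq : signalingPolytope n (d + 1) d = mlPolytope n (d + 1) d :=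
      (signalingPolytope_subset_mlPolytope le_rfl).antisymm (mlPolytope_subset_signalingPolytope hn)
    refine ⟨heq, mlPolytope_eq_setOf_sum_iSup_le hn, fun P _ => ⟨?_, fun h => ?_⟩⟩
    · rintro ⟨m, -, hm, h⟩
      exact signalingPolytope_subset_mlPolytope (Nat.le_of_lt_succ hm) h
    · exact ⟨d, hd, d.lt_succ_self, heq ▸ h⟩
  · rintro rfl
    refine ⟨Set.Subset.antisymm (fun P h => ⟨h.1, Set.mem_iInter₂.2 fun k _ => ?_⟩) fun P h => ?_,
      fun P hP => ⟨?_, fun h => ?_⟩⟩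
    · exact signalingPolytope_subset_ambiguousPolytope le_rfl k h
    · exact mem_signalingPolytope_of_forall_mem_ambiguousPolytope h.1 fun k hk hk' =>
        Set.mem_iInter₂.1 h.2 k ⟨hk, hk'⟩
    · rintro ⟨m, -, hm, h⟩ k - -
      exact signalingPolytope_subset_ambiguousPolytope (Nat.le_of_lt_succ hm) k h
    · exact ⟨d, hd, d.lt_succ_self, mem_signalingPolytope_of_forall_mem_ambiguousPolytope hP h⟩
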